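/- Let $\mathcal A=\{c<d\}$ be a two-letter alphabet of positive integers that is either of the form $\{2a<2b\}$ with integers $1\le a<b$, or of the form $\{1<2b+1\}$ with an integer $b\ge 1$. For a finite or infinite word $w$ over $\mathcal A$, let $\Delta(w)$ be its run-length encoding, that is, the word over the positive integers formed by the lengths of the successive maximal blocks of equal letters of $w$ (for an infinite word all of whose blocks are finite, $\Delta(w)$ is an infinite word; otherwise it is not). An infinite word $w\in\mathcal A^\omega$ is smooth if $\Delta^k(w)\in\mathcal A^\omega$ for all $k\ge 0$. For a finite word $w$, let $D(w)$ be the word obtained from $\Delta(w)$ by deleting its first letter if it is smaller than $d$ and its last letter if it is smaller than $d$ (so $D(w)=\varepsilon$ if $w=\varepsilon$ or if $\Delta(w)$ is a single letter smaller than $d$; $D(w)$ is undefined if the first or last letter of $\Delta(w)$ exceeds $d$). A finite word $w$ is a smooth factor if there is $k\in\mathbb N$ such that $D^k(w)=\varepsilon$ and $D^j(w)\in\mathcal A^*$ for all $j<k$. Then no infinite smooth word $w\in\mathcal A^\omega$ contains every smooth factor: for every infinite smooth word $w$ over $\mathcal A$ there is a smooth factor $f$ that does not occur in $w$ as a block of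 consecutive letters. -/

import Mathlib

namespace SmoothWords

/-- The finite word `w` is a word over the alphabet `{a, b}`. -/
def IsWordOver (a b : ℕ) (w : List ℕ) : Prop :=
  ∀ x ∈ w, x = a ∨ x = b

/-- The (right) infinite word `w` is a word over the alphabet `{a, b}`. -/
def IsInfWordOver (a b : ℕ) (w : ℕ → ℕ) : Prop :=
  ∀ n, w n = a ∨ w n = b

/-- Run-length encoding `Δ` of a finite word: the list of lengths of its maximal blocks. -/
def runLength (w : List ℕ) : List ℕ :=
  (w.splitBy (fun x y => x == y)).map List.length

/-- A maximal block of the infinite word `w` starts at position `n`. -/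
def IsBlockStart (w : ℕ → ℕ) (n : ℕ) : Prop :=
  n = 0 ∨ w n ≠ w (n - 1)

/-- Run-length encoding `Δ` of an infinite word: the `k`-th letter is the length of the `k`-th
maximal block, that is, the distance between the `k`-th and the `(k+1)`-st block start
(counted from `0`). If `w` is eventually constant, it has an infinite last block and `Δ w` is not
an infinite word; then `Nat.nth` returns `0` past the last block start, so the value of
`infRunLength w` at the last block is `0`, which is not a letter of any alphabet of positive
integers. -/
noncomputable def infRunLength (w : ℕ → ℕ) : ℕ → ℕ :=
  fun k => Nat.nth (IsBlockStart w) (k + 1) - Nat.nth (IsBlockStart w) k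

/-- Infinite smooth words over the alphabet `{a < b}` of positive integers: all the iterates
`Δ^k w` are infinite words over `{a, b}`. -/
def IsInfSmooth (a b : ℕ) (w : ℕ → ℕ) : Prop :=
  ∀ k, IsInfWordOver a b (infRunLength^[k] w)

/-- Remove the first letter of a word if it is smaller than `b`. -/
def trimHead (b : ℕ) : List ℕ → List ℕ
  | [] => []
  | u :: x => if u < b then x else u :: x

/-- Remove the last letter of a word if it is smaller than `b`. -/
def trimLast (b : ℕ) (x : List ℕ) : List ℕ :=
  (trimHead b x.reverse).reverse

/-- The derivative `D` over the alphabet `{a < b}`: run-length encode, then remove the first and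
the last letter if they are smaller than `b`. (If the first or the last letter of `Δ w` exceeds
`b`, then `D` is usually left undefined; here that letter is kept, so that `D w` is not empty and
not a word over the alphabet.) -/
def deriv (b : ℕ) (w : List ℕ) : List ℕ :=
  trimLast b (trimHead b (runLength w))

/-- Smooth factors over the alphabet `{a < b}`: for some `k`, `D^k w` is the empty word and
`D^j w` is a word over the alphabet for all `j < k`. -/
def IsSmoothFactor (a b : ℕ) (w : List ℕ) : Prop :=
  ∃ k, (deriv b)^[k] w = [] ∧ ∀ j < k, IsWordOver a b ((deriv b)^[j] w)

/-- The infinite word `w` contains the finite word `f` as a factor. -/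
def Contains (w : ℕ → ℕ) (f : List ℕ) : Prop :=
  ∃ i, ∀ (j : ℕ) (hj : j < f.length), w (i + j) = f[j]

end SmoothWords

namespace SmoothWords

section BlockStarts

variable {w : ℕ → ℕ}

/-! In both alphabets `c` and `d` have the same parity. All blocks of `Δ w` then have lengths of
that parity, so the blocks of letter `c` in `Δ w` start at positions of one parity
(`even_iff_even_of_isBlockStart`). Blocks of `w` alternate, so the parity of a block's index
determines its letter. Hence every block of `w` indexed by a position where `Δ w` passes from `d` to
`c` has the same letter. The smooth factors `c d^d c^c d` and `d c^d d^c c` both force such a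
passage, but with different letters, so `w` misses one of them. -/

lemma isBlockStart_nth (w : ℕ → ℕ) (k : ℕ) : IsBlockStart w (Nat.nth (IsBlockStart w) k) := by
  -- Past the last block start `Nat.nth` returns `0`, which is itself a block start.
  rcases Nat.range_nth_subset (p := IsBlockStart w) ⟨k, rfl⟩ with h | h
  · exact Or.inl h
  · exact h

lemma nth_isBlockStart_zero (w : ℕ → ℕ) : Nat.nth (IsBlockStart w) 0 = 0 :=
  Nat.nth_zero_of_zero (Or.inl rfl)

lemma exists_nth_eq {n : ℕ} (h : IsBlockStart w n) : ∃ k, Nat.nth (IsBlockStart w) k = n :=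
  Nat.subset_range_nth h

/-- With truncated subtraction, a nonzero difference means a strict increase; this excludes an
infinite last block. -/
lemma strictMono_nth (hw : ∀ k, infRunLength w k ≠ 0) : StrictMono (Nat.nth (IsBlockStart w)) :=
  strictMono_nat_of_lt_succ fun k => by
    have h := hw k
    unfold infRunLength at h
    omega

lemma nth_succ_eq (hw : ∀ k, infRunLength w k ≠ 0) (k : ℕ) :
    Nat.nth (IsBlockStart w) (k + 1) = Nat.nth (IsBlockStart w) k + infRunLength w k := by
  have h := strictMono_nth hw (Nat.lt_add_one k)
  unfold infRunLength
  omega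

/-- Two block starts with no block start strictly between them are consecutive. -/
lemma nth_succ_eq_of_forall_not (hw : ∀ k, infRunLength w k ≠ 0) {k q : ℕ}
    (hq : IsBlockStart w q) (hlt : Nat.nth (IsBlockStart w) k < q)
    (h : ∀ n, Nat.nth (IsBlockStart w) k < n → n < q → ¬ IsBlockStart w n) :
    Nat.nth (IsBlockStart w) (k + 1) = q := by
  have hm := strictMono_nth hw
  obtain ⟨m, rfl⟩ := exists_nth_eq hq
  have hkm : k + 1 ≤ m := hm.lt_iff_lt.1 hlt
  rcases hkm.eq_or_lt with rfl | hkm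
  · rfl
  · exact (h _ (hm k.lt_succ_self) (hm hkm) (isBlockStart_nth w _)).elim

lemma apply_eq_of_mem_block {k n : ℕ} (h₁ : Nat.nth (IsBlockStart w) k ≤ n)
    (h₂ : n < Nat.nth (IsBlockStart w) (k + 1)) : w n = w (Nat.nth (IsBlockStart w) k) := by
  induction n, h₁ using Nat.le_induction with
  | base => rfl
  | succ n hn ih =>
    rw [← ih (by omega)]
    by_contra hne
    have := Nat.le_nth_of_lt_nth_succ h₂ (Or.inr hne)
    omega

lemma apply_nth_succ_ne (hw : ∀ k, infRunLength w k ≠ 0) (k : ℕ) :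
    w (Nat.nth (IsBlockStart w) (k + 1)) ≠ w (Nat.nth (IsBlockStart w) k) := by
  have hlt := strictMono_nth hw (Nat.lt_add_one k)
  rcases isBlockStart_nth w (k + 1) with h | h
  · omega
  · rwa [apply_eq_of_mem_block (w := w) (k := k) (n := Nat.nth (IsBlockStart w) (k + 1) - 1)
      (by omega) (by omega)] at h

/-- In a word over two letters the blocks alternate, so the parity of the index of a block
determines its letter, and conversely. -/
lemma apply_nth_eq_zero_iff {a b : ℕ} (hab : IsInfWordOver a b w)
    (hw : ∀ k, infRunLength w k ≠ 0) (k : ℕ) :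
    w (Nat.nth (IsBlockStart w) k) = w 0 ↔ Even k := by
  induction k with
  | zero => simp [nth_isBlockStart_zero]
  | succ k ih =>
    rw [Nat.even_add_one, ← ih]
    have h := apply_nth_succ_ne hw k
    rcases hab (Nat.nth (IsBlockStart w) (k + 1)) with h₁ | h₁ <;>
    rcases hab (Nat.nth (IsBlockStart w) k) with h₂ | h₂ <;>
    rcases hab 0 with h₃ | h₃ <;> simp only [h₁, h₂, h₃] at h ⊢ <;> tauto

lemma even_iff_even_of_apply_nth_eq {a b : ℕ} (hab : IsInfWordOver a b w)
    (hw : ∀ k, infRunLength w k ≠ 0) {j k : ℕ}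
    (h : w (Nat.nth (IsBlockStart w) j) = w (Nat.nth (IsBlockStart w) k)) :
    Even j ↔ Even k := by
  rw [← apply_nth_eq_zero_iff hab hw, ← apply_nth_eq_zero_iff hab hw, h]

lemma apply_nth_eq_of_even_iff_even {a b : ℕ} (hab : IsInfWordOver a b w)
    (hw : ∀ k, infRunLength w k ≠ 0) {j k : ℕ} (h : Even j ↔ Even k) :
    w (Nat.nth (IsBlockStart w) j) = w (Nat.nth (IsBlockStart w) k) := by
  rw [← apply_nth_eq_zero_iff hab hw, ← apply_nth_eq_zero_iff hab hw] at h
  have h₁ := hab (Nat.nth (IsBlockStart w) j)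
  have h₂ := hab (Nat.nth (IsBlockStart w) k)
  have h₃ := hab 0
  grind

/-- If all blocks have lengths of the same parity, the `j`-th block starts at a position of the
parity of `c * j`. -/
lemma even_nth_iff {c : ℕ} (hw : ∀ k, infRunLength w k ≠ 0)
    (hc : ∀ k, Even (infRunLength w k) ↔ Even c) (j : ℕ) :
    Even (Nat.nth (IsBlockStart w) j) ↔ Even (c * j) := by
  induction j with
  | zero => simp [nth_isBlockStart_zero]
  | succ j ih => rw [nth_succ_eq hw, Nat.even_add, ih, hc, mul_add, Nat.even_add, mul_one]

/-- If all blocks have lengths of the same parity, the positions at which blocks of a given letter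
start all have the same parity. -/
lemma even_iff_even_of_isBlockStart {a b c : ℕ} (hab : IsInfWordOver a b w)
    (hw : ∀ k, infRunLength w k ≠ 0) (hc : ∀ k, Even (infRunLength w k) ↔ Even c) {m n : ℕ}
    (hm : IsBlockStart w m) (hn : IsBlockStart w n) (h : w m = w n) : Even m ↔ Even n := by
  obtain ⟨i, rfl⟩ := exists_nth_eq hm
  obtain ⟨j, rfl⟩ := exists_nth_eq hn
  rw [even_nth_iff hw hc, even_nth_iff hw hc, Nat.even_mul, Nat.even_mul,
    even_iff_even_of_apply_nth_eq hab hw h]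

end BlockStarts

/-- The word `y x^d y^c x`. -/
def twoBlockWord (c d x y : ℕ) : List ℕ :=
  [[y], List.replicate d x, List.replicate c y, [x]].flatten

lemma runLength_twoBlockWord {c d x y : ℕ} (hc : 0 < c) (hd : 0 < d) (hxy : x ≠ y) :
    runLength (twoBlockWord c d x y) = [1, d, c, 1] := by
  rw [runLength, twoBlockWord, List.splitBy_flatten]
  · simp
  · simp; omega
  · simp [List.isChain_replicate_of_rel]
  · have hd' := hd.ne'
    have hc' := hc.ne'
    simp [hd', hc', hxy, hxy.symm]

/-- The two outer runs have length `1 < d` and are trimmed; trimming acts only once at each end, so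
`c` survives. -/
lemma deriv_twoBlockWord {c d x y : ℕ} (hc : 0 < c) (hcd : c < d) (hxy : x ≠ y) :
    deriv d (twoBlockWord c d x y) = [d, c] := by
  have h1 : 1 < d := by omega
  rw [deriv, runLength_twoBlockWord hc (by omega) hxy]
  simp [trimHead, trimLast, h1]

lemma isSmoothFactor_twoBlockWord {c d x y : ℕ} (hc : 0 < c) (hcd : c < d) (hxy : x ≠ y)
    (hx : x = c ∨ x = d) (hy : y = c ∨ y = d) :
    IsSmoothFactor c d (twoBlockWord c d x y) := by
  have h1 : 1 < d := by omega
  have hD := deriv_twoBlockWord hc hcd hxy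
  refine ⟨2, ?_, fun j hj => ?_⟩
  · have hr : runLength [d, c] = [1, 1] := by
      have := List.splitBy_flatten (r := fun x y : ℕ => x == y) (l := [[d], [c]])
        (by simp) (by simp) (by simp [hcd.ne'])
      simp only [List.flatten_cons, List.flatten_nil, List.cons_append, List.nil_append] at this
      simp [runLength, this]
    rw [Function.iterate_succ_apply, hD, Function.iterate_one, deriv, hr]
    simp [trimHead, trimLast, h1]
  · interval_cases j
    · intro z hz
      simp only [Function.iterate_zero, id, twoBlockWord, List.mem_flatten, List.mem_cons,
        List.not_mem_nil, or_false] at hz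
      obtain ⟨l, rfl | rfl | rfl | rfl, hz⟩ := hz <;> simp at hz <;> grind
    · rw [Function.iterate_one, hD]
      intro z hz
      simp at hz
      tauto

/-- The outer letters `y` and `x` delimit the two inner runs, which are therefore complete blocks of
`w`. -/
lemma Contains.exists_nth {c d x y : ℕ} {w : ℕ → ℕ} (hw : ∀ k, infRunLength w k ≠ 0)
    (hc : 0 < c) (hd : 0 < d) (hxy : x ≠ y) (h : Contains w (twoBlockWord c d x y)) :
    ∃ k, infRunLength w k = d ∧ infRunLength w (k + 1) = c ∧
      w (Nat.nth (IsBlockStart w) (k + 1)) = y := by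
  obtain ⟨i, hi⟩ := h
  have hlen : (twoBlockWord c d x y).length = 1 + d + c + 1 := by
    simp [twoBlockWord]; omega
  have h₀ : w i = y := by
    have := hi 0 (by omega)
    simpa [twoBlockWord] using this
  have h₁ : ∀ n, i + 1 ≤ n → n < i + 1 + d → w n = x := by
    intro n hn hn'
    have := hi (n - i) (by omega)
    rw [show i + (n - i) = n by omega] at this
    rw [this]
    simp [twoBlockWord, List.getElem_cons, List.getElem_append]
    grind
  have h₂ : ∀ n, i + 1 + d ≤ n → n < i + 1 + d + c → w n = y := by
    intro n hn hn'
    have := hi (n - i) (by omega)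
    rw [show i + (n - i) = n by omega] at this
    rw [this]
    simp [twoBlockWord, List.getElem_cons, List.getElem_append]
    grind
  have h₃ : w (i + 1 + d + c) = x := by
    have := hi (1 + d + c) (by omega)
    rw [show i + (1 + d + c) = i + 1 + d + c by omega] at this
    rw [this]
    simp [twoBlockWord, List.getElem_cons, List.getElem_append]
    grind
  obtain ⟨k, hk⟩ := exists_nth_eq (w := w) (n := i + 1) <| Or.inr <| by
    rw [Nat.add_sub_cancel, h₀, h₁ _ le_rfl (by omega)]
    exact hxy
  have hk₁ : Nat.nth (IsBlockStart w) (k + 1) = i + 1 + d := by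
    refine nth_succ_eq_of_forall_not hw (Or.inr ?_) (by omega) ?_
    · rw [h₂ _ le_rfl (by omega), h₁ _ (by omega) (by omega)]
      exact hxy.symm
    · rintro n hn hn' (h | h)
      · omega
      · exact h ((h₁ n (by omega) hn').trans (h₁ (n - 1) (by omega) (by omega)).symm)
  have hk₂ : Nat.nth (IsBlockStart w) (k + 1 + 1) = i + 1 + d + c := by
    refine nth_succ_eq_of_forall_not hw (Or.inr ?_) (by omega) ?_
    · rw [h₃, h₂ _ (by omega) (by omega)]
      exact hxy
    · rintro n hn hn' (h | h)
      · omega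
      · exact h ((h₂ n (by omega) hn').trans (h₂ (n - 1) (by omega) (by omega)).symm)
  refine ⟨k, ?_, ?_, ?_⟩
  · have := nth_succ_eq hw k
    omega
  · have := nth_succ_eq hw (k + 1)
    omega
  · rw [hk₁, h₂ _ le_rfl (by omega)]

/-- Over letters of the same parity, no infinite smooth word contains both `c d^d c^c d` and
`d c^d d^c c`. -/
theorem IsInfSmooth.not_contains_both {c d : ℕ} (hc : 0 < c) (hcd : c < d)
    (hpar : Even d ↔ Even c) {w : ℕ → ℕ} (hw : IsInfSmooth c d w) :
    ¬ (Contains w (twoBlockWord c d d c) ∧ Contains w (twoBlockWord c d c d)) := by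
  rintro ⟨h₁, h₂⟩
  have hw₀ : IsInfWordOver c d w := hw 0
  have hw₁ : IsInfWordOver c d (infRunLength w) := hw 1
  have hw₂ : IsInfWordOver c d (infRunLength (infRunLength w)) := hw 2
  have hpos : ∀ k, infRunLength w k ≠ 0 := fun k => by rcases hw₁ k with h | h <;> omega
  have hpos' : ∀ k, infRunLength (infRunLength w) k ≠ 0 := fun k => by
    rcases hw₂ k with h | h <;> omega
  obtain ⟨j, hj, hj', hjw⟩ := h₁.exists_nth hpos hc (by omega) hcd.ne'
  obtain ⟨k, hk, hk', hkw⟩ := h₂.exists_nth hpos hc (by omega) hcd.ne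
  -- Positions `j + 1` and `k + 1` of `Δ w` carry `c` just after a `d`, so each starts a block of
  -- letter `c`.
  have heven : Even (j + 1) ↔ Even (k + 1) :=
    even_iff_even_of_isBlockStart hw₁ hpos' (c := c)
      (fun n => by rcases hw₂ n with h | h <;> rw [h]; exact hpar)
      (Or.inr (by rw [Nat.add_sub_cancel, hj, hj']; exact hcd.ne))
      (Or.inr (by rw [Nat.add_sub_cancel, hk, hk']; exact hcd.ne)) (hj'.trans hk'.symm)
  -- Blocks `j + 1` and `k + 1` of `w` would share a letter, yet one consists of `c` and the other
  -- of `d`.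
  have := apply_nth_eq_of_even_iff_even hw₀ hpos heven
  omega

end SmoothWords

theorem corollary36 (c d : ℕ)
    (hA : (∃ a b : ℕ, 0 < a ∧ a < b ∧ c = 2 * a ∧ d = 2 * b) ∨
      (∃ b : ℕ, 0 < b ∧ c = 1 ∧ d = 2 * b + 1))
    (w : ℕ → ℕ) (hw : SmoothWords.IsInfSmooth c d w) :
    ¬ ∀ f : List ℕ, SmoothWords.IsSmoothFactor c d f → SmoothWords.Contains w f := by
  intro h
  obtain ⟨hc, hcd, hpar⟩ : 0 < c ∧ c < d ∧ (Even d ↔ Even c) := by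
    simp only [Nat.even_iff]
    rcases hA with ⟨a, b, ha, hab, rfl, rfl⟩ | ⟨b, hb, rfl, rfl⟩ <;>
      exact ⟨by omega, by omega, by omega⟩
  exact hw.not_contains_both hc hcd hpar
    ⟨h _ (SmoothWords.isSmoothFactor_twoBlockWord hc hcd hcd.ne' (Or.inr rfl) (Or.inl rfl)),
      h _ (SmoothWords.isSmoothFactor_twoBlockWord hc hcd hcd.ne (Or.inl rfl) (Or.inr rfl))⟩
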